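/- Write $\omega\mathbf{Cpo}$ for the category of $\omega$-complete partial orders (posets with suprema of $\omega$-chains, a least element not being required) and monotone $\omega$-continuous maps. An $\omega\mathbf{Cpo}$-category is a category whose hom-sets are $\omega$-cpos and whose composition is $\omega$-continuous; an $\omega\mathbf{Cpo}$-functor is a functor that is $\omega$-continuous on homs; an $\omega\mathbf{Cpo}$-adjunction is one whose hom-bijections are isomorphisms of $\omega$-cpos. A monotone map is full if it reflects the order; a morphism $j$ of an $\omega\mathbf{Cpo}$-category $\mathcal V$ is full if $\mathcal V(B,j)$ is full for all $B$. An ep-pair is a pair $e:A\to B$, $p:B\to A$ with $p\circ e=\mathrm{id}$ and $e\circ p\le\mathrm{id}$. An ep-zero object is a zero object $\mathfrak O$ such that, for every $A$, the unique morphisms $\mathfrak O\to A$ and $A\to\mathfrak O$ form an ep-pair. Throughout, finite products, exponentials, finite coproducts and (small, weighted) $\omega\mathbf{Cpo}$-colimits are chosen, and "strictly" means "on the nose for the chosen structure". A CBV pair $(\mathcal V,T)$ is a bicartesian closed category $\mathcal V$ with a strong (equivalently, $\mathcal V$-enriched) monad $T$. A CBV pair morphism is a functor $H$ that strictly preserves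 the bicartesian closed structure and satisfies $HT=T'H$, $H\eta=\eta'_H$, $H\mu=\mu'_H$. An rCBV $\omega\mathbf{Cpo}$-pair is a CBV pair $(\mathcal V,T)$, with Kleisli category $\mathcal C$ (ordered by $\mathcal C(A,B)=\mathcal V(A,TB)$) and canonical functor $J:\mathcal V\to\mathcal C$, such that: 1. $\mathcal V$ is an $\omega\mathbf{Cpo}$-cocomplete, $\omega\mathbf{Cpo}$-cartesian closed $\omega\mathbf{Cpo}$-category (its finite products are $\omega\mathbf{Cpo}$-products and each $B\times-$ has a right $\omega\mathbf{Cpo}$-adjoint $[B,-]$); 2. every component of the unit of $T$ is a full morphism; 3. $J(\mathsf 0)$, with $\mathsf 0$ initial in $\mathcal V$, is an ep-zero object of $\mathcal C$; 4. for every ep-pair $(e,p)$ from $J(A)$ to $J(B)$ in $\mathcal C$ there is exactly one $f:A\to B$ in $\mathcal V$ with $J(f)=e$. A morphism of rCBV $\omega\mathbf{Cpo}$-pairs is an $\omega\mathbf{Cpo}$-functor that strictly preserves $\omega\mathbf{Cpo}$-colimits and is a CBV pair morphism. Let $(\mathcal V,T)$ be an rCBV $\omega\mathbf{Cpo}$-pair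 and let $G:\mathcal V\to\omega\mathbf{Cpo}$ be an $\omega\mathbf{Cpo}$-functor that is a right $\omega\mathbf{Cpo}$-adjoint. The subscone $\mathbf{Sub}(\omega\mathbf{Cpo}\downarrow G)$ is the full subcategory of the comma category $\omega\mathbf{Cpo}\downarrow G$ on the objects $(D,C,j:D\to G(C))$ with $j$ full; its morphisms $(\alpha_0:D\to D',\alpha_1:C\to C')$ are ordered componentwise. Let $U:\mathbf{Sub}(\omega\mathbf{Cpo}\downarrow G)\to\mathcal V$, $(D,C,j)\mapsto C$, be the forgetful functor; the subscone has finite products lying strictly over those of $\mathcal V$. **Theorem.** Let $L$ be a strong monad on $\mathbf{Sub}(\omega\mathbf{Cpo}\downarrow G)$ that lifts $T$ along $U$, i.e. $UL=TU$, $U\eta^L=\eta^T_U$ and $U\mu^L=\mu^T_U$. Assume: (A) for every object $X=(D,C,j)$ of the subscone, with $LX=(\bar D,TC,\bar\jmath)$ and unit component $\eta^L_X=(\eta_0:D\to\bar D,\ \eta^T_C:C\to TC)$, the square $\bar\jmath\circ\eta_0=G(\eta^T_C)\circ j$ is a pullback in $\omega\mathbf{Cpo}$; (B) $L(\mathsf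 0,\mathsf 0,j)$ is terminal in the subscone, where $(\mathsf 0,\mathsf 0,j)$ is the object over the initial object $\mathsf 0$ of $\mathcal V$ with the empty $\omega$-cpo as first component. Then, for a suitable choice of exponentials, finite coproducts and $\omega\mathbf{Cpo}$-colimits on the subscone, $(\mathbf{Sub}(\omega\mathbf{Cpo}\downarrow G),L)$ is an rCBV $\omega\mathbf{Cpo}$-pair and $U:(\mathbf{Sub}(\omega\mathbf{Cpo}\downarrow G),L)\to(\mathcal V,T)$ is a morphism of rCBV $\omega\mathbf{Cpo}$-pairs. -/

import Mathlib

open CategoryTheory MonoidalCategory CartesianMonoidalCategory Limits Opposite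
open OmegaCompletePartialOrder

universe v u v' u'

namespace OmegaCpo

/-! ### `ωCpo`-categories, `ωCpo`-functors, `ωCpo`-adjunctions -/

/-- A category enriched in `ω`-cpos: the hom-sets are `ω`-cpos (possibly without least element)
and composition is jointly `ω`-continuous. -/
class OmegaCpoCategory (V : Type u) [Category.{v} V] where
  homOrder (X Y : V) : OmegaCompletePartialOrder (X ⟶ Y)
  comp_continuous (X Y Z : V) :
    ωScottContinuous (fun p : (X ⟶ Y) × (Y ⟶ Z) => p.1 ≫ p.2)

attribute [reducible, instance] OmegaCpoCategory.homOrder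

/-- An `ωCpo`-functor: a functor whose actions on the hom-`ω`-cpos are `ω`-continuous. -/
class OmegaCpoFunctor {V : Type u} [Category.{v} V] [OmegaCpoCategory V]
    {W : Type u'} [Category.{v'} W] [OmegaCpoCategory W] (F : V ⥤ W) : Prop where
  map_continuous (X Y : V) : ωScottContinuous (fun f : X ⟶ Y => F.map f)

/-- An adjunction is an `ωCpo`-adjunction when its hom-bijections are isomorphisms of `ω`-cpos
(order isomorphisms preserve suprema automatically). -/
def IsOmegaCpoAdjunction {V : Type u} [Category.{v} V] [OmegaCpoCategory V]
    {W : Type u'} [Category.{v'} W] [OmegaCpoCategory W] {F : V ⥤ W} {G : W ⥤ V}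
    (adj : F ⊣ G) : Prop :=
  ∀ (X : V) (Y : W) (f g : F.obj X ⟶ Y),
    adj.homEquiv X Y f ≤ adj.homEquiv X Y g ↔ f ≤ g

/-- The `ωCpo`-functor `G` is a right `ωCpo`-adjoint. -/
def IsRightOmegaCpoAdjoint {V : Type u} [Category.{v} V] [OmegaCpoCategory V]
    {W : Type u'} [Category.{v'} W] [OmegaCpoCategory W] (G : W ⥤ V) [OmegaCpoFunctor G] :
    Prop :=
  ∃ (F : V ⥤ W) (adj : F ⊣ G), OmegaCpoFunctor F ∧ IsOmegaCpoAdjunction adj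

instance {V : Type u} [Category.{v} V] [OmegaCpoCategory V]
    {W : Type u'} [Category.{v'} W] [OmegaCpoCategory W] {X : Type*} [Category X]
    [OmegaCpoCategory X] (F : V ⥤ W) (G : W ⥤ X) [OmegaCpoFunctor F] [OmegaCpoFunctor G] :
    OmegaCpoFunctor (F ⋙ G) where
  map_continuous A B :=
    (OmegaCpoFunctor.map_continuous (F := G) (F.obj A) (F.obj B)).comp
      (OmegaCpoFunctor.map_continuous (F := F) A B)

/-- A monotone map is full when it reflects the order. -/
def FullMap {A B : Type*} [LE A] [LE B] (f : A → B) : Prop :=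
  ∀ ⦃x y : A⦄, f x ≤ f y → x ≤ y

/-- A morphism `j` of an `ωCpo`-category is full when `V(B, j)` is full for every `B`. -/
def FullMorphism {V : Type u} [Category.{v} V] [OmegaCpoCategory V] {X Y : V} (j : X ⟶ Y) :
    Prop :=
  ∀ B : V, FullMap (fun f : B ⟶ X => f ≫ j)

/-- `(e, p)` is an embedding-projection pair. -/
structure IsEpPair {C : Type u} [Category.{v} C] [∀ X Y : C, PartialOrder (X ⟶ Y)] {A B : C}
    (e : A ⟶ B) (p : B ⟶ A) : Prop where
  proj_comp : e ≫ p = 𝟙 A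
  comp_proj : p ≫ e ≤ 𝟙 B

/-- An ep-zero object: a zero object for which, for every object `A`, the unique morphisms
`Z ⟶ A` and `A ⟶ Z` form an ep-pair. -/
structure IsEpZero {C : Type u} [Category.{v} C] [∀ X Y : C, PartialOrder (X ⟶ Y)] (Z : C) :
    Prop where
  isZero : IsZero Z
  isEpPair (A : C) : IsEpPair (isZero.to_ A) (isZero.from_ A)

/-- `ωCpo` as a category enriched in itself: morphisms are ordered pointwise. -/
instance omegaCpoHom (X Y : ωCPO.{v}) : OmegaCompletePartialOrder (X ⟶ Y) :=
  inferInstanceAs (OmegaCompletePartialOrder (X →𝒄 Y))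

instance : OmegaCpoCategory ωCPO.{v} where
  homOrder X Y := omegaCpoHom X Y
  comp_continuous X Y Z := by
    have h1 : ∀ f : X →𝒄 Y, ωScottContinuous (fun g : Y →𝒄 Z => g.comp f) := fun f =>
      ωScottContinuous.of_monotone_map_ωSup ⟨fun g g' h x => h (f x), fun c => rfl⟩
    refine ωScottContinuous.of_monotone_map_ωSup ⟨?_, ?_⟩
    · rintro ⟨f, g⟩ ⟨f', g'⟩ ⟨h, h'⟩ x
      exact le_trans (g.monotone (h x)) (h' (f' x))
    · intro c
      refine ContinuousHom.ext _ _ fun x => ?_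
      have h2 := ContinuousHom.ωScottContinuous_apply
        (f := fun p : (X →𝒄 Y) × (Y →𝒄 Z) => p.2) (g := fun p => p.1 x)
        Prod.ωScottContinuous_snd (by
          refine ωScottContinuous.of_monotone_map_ωSup ⟨fun p q h => h.1 x, fun c => rfl⟩)
      exact h2.map_ωSup c

/-! ### Weighted colimits -/

/-- A weight on the small `ωCpo`-category `J`: an `ωCpo`-functor `Jᵒᵖ ⥤ ωCpo`. -/
class OmegaCpoWeight {J : Type v} [SmallCategory J] [OmegaCpoCategory J]
    (W : Jᵒᵖ ⥤ ωCPO.{v}) : Prop where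
  map_continuous (i j : J) : ωScottContinuous (fun f : i ⟶ j => W.map f.op)

/-- A `W`-weighted cocone on `K`: an object `pt` with an `ωCpo`-natural transformation
`W ⟶ V(K -, pt)`. -/
@[ext]
structure WeightedCocone {V : Type u} [Category.{v} V] [OmegaCpoCategory V]
    {J : Type v} [SmallCategory J] (W : Jᵒᵖ ⥤ ωCPO.{v}) (K : J ⥤ V) where
  pt : V
  leg (j : J) : W.obj (op j) →𝒄 (K.obj j ⟶ pt)
  naturality {i j : J} (f : i ⟶ j) (w : W.obj (op j)) :
    K.map f ≫ leg j w = leg i ((W.map f.op : W.obj (op j) →𝒄 W.obj (op i)) w)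

/-- The image of a weighted cocone under an `ωCpo`-functor. -/
def WeightedCocone.map {V : Type u} [Category.{v} V] [OmegaCpoCategory V]
    {V' : Type u'} [Category.{v} V'] [OmegaCpoCategory V']
    {J : Type v} [SmallCategory J] {W : Jᵒᵖ ⥤ ωCPO.{v}} {K : J ⥤ V}
    (c : WeightedCocone W K) (H : V ⥤ V') [OmegaCpoFunctor H] : WeightedCocone W (K ⋙ H) where
  pt := H.obj c.pt
  leg j := ContinuousHom.ofFun (fun w => H.map (c.leg j w))
    ((OmegaCpoFunctor.map_continuous (F := H) _ _).comp (c.leg j).ωScottContinuous)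
  naturality f w := by
    change H.map (K.map f) ≫ H.map _ = H.map _
    rw [← H.map_comp, c.naturality]

/-- The weighted cocone `c` is a `W`-weighted `ωCpo`-colimit of `K`: composition with `c` is an
isomorphism of `ω`-cpos from `V(c.pt, X)` onto the `ω`-cpo of weighted cocones with vertex `X`.
(Uniqueness of factorizations follows from `le_of_legs` and antisymmetry.) -/
structure WeightedCocone.IsColimit {V : Type u} [Category.{v} V] [OmegaCpoCategory V]
    {J : Type v} [SmallCategory J] {W : Jᵒᵖ ⥤ ωCPO.{v}} {K : J ⥤ V}
    (c : WeightedCocone W K) : Prop where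
  exists_fac (s : WeightedCocone W K) :
    ∃ h : c.pt ⟶ s.pt, ∀ (j : J) (w : W.obj (op j)), c.leg j w ≫ h = s.leg j w
  le_of_legs {X : V} (f g : c.pt ⟶ X) :
    (∀ (j : J) (w : W.obj (op j)), c.leg j w ≫ f ≤ c.leg j w ≫ g) → f ≤ g

/-! ### CBV pairs and rCBV `ωCpo`-pairs -/

/-- A strong monad on a category with chosen finite products (equivalently, if the category is
closed, a monad enriched in the category itself). -/
structure StrongMonad (V : Type u) [Category.{v} V] [CartesianMonoidalCategory V]
    extends Monad V where
  strength (A B : V) : A ⊗ obj B ⟶ obj (A ⊗ B)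
  strength_natural {A A' B B' : V} (f : A ⟶ A') (g : B ⟶ B') :
    (f ⊗ₘ map g) ≫ strength A' B' = strength A B ≫ map (f ⊗ₘ g)
  strength_leftUnitor (A : V) :
    strength (𝟙_ V) A ≫ map (λ_ A).hom = (λ_ (obj A)).hom
  strength_associator (A B C : V) :
    strength (A ⊗ B) C ≫ map (α_ A B C).hom =
      (α_ A B (obj C)).hom ≫ A ◁ strength B C ≫ strength A (B ⊗ C)
  strength_unit (A B : V) :
    A ◁ η.app B ≫ strength A B = η.app (A ⊗ B)
  strength_mul (A B : V) :
    A ◁ μ.app B ≫ strength A B =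
      strength A (obj B) ≫ map (strength A B) ≫ μ.app (A ⊗ B)

/-- The rest of a chosen bicartesian closed structure on a category with chosen finite products:
chosen exponentials, a chosen initial object and chosen binary coproducts.

A CBV pair is a category with chosen finite products and such a structure, together with a
`StrongMonad` on it. -/
structure BicartesianClosed (V : Type u) [Category.{v} V] [CartesianMonoidalCategory V] where
  closed : MonoidalClosed V
  zero : V
  zeroIsInitial : IsInitial zero
  coprod (A B : V) : V
  inl (A B : V) : A ⟶ coprod A B
  inr (A B : V) : B ⟶ coprod A B
  coprodIsColimit (A B : V) : IsColimit (BinaryCofan.mk (inl A B) (inr A B))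

namespace BicartesianClosed

variable {V : Type u} [Category.{v} V] [CartesianMonoidalCategory V]

/-- The functor `[A, -]`. -/
def ihomFunctor (P : BicartesianClosed V) (A : V) : V ⥤ V :=
  letI := P.closed
  ihom A

/-- The adjunction `(A × -) ⊣ [A, -]`. -/
def ihomAdj (P : BicartesianClosed V) (A : V) : tensorLeft A ⊣ P.ihomFunctor A :=
  letI := P.closed
  ihom.adjunction A

/-- The exponential `[A, B]`. -/
def exp (P : BicartesianClosed V) (A B : V) : V := (P.ihomFunctor A).obj B

/-- Evaluation. -/
def ev (P : BicartesianClosed V) (A B : V) : A ⊗ P.exp A B ⟶ B :=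
  (P.ihomAdj A).counit.app B

end BicartesianClosed

/-- The functor `H` strictly (on the nose) carries the monad `S` to the monad `T`; in other words
`S` is a lifting of `T` along `H`. -/
structure LiftsMonad {V : Type u} [Category.{v} V] {V' : Type u'} [Category.{v'} V']
    (H : V ⥤ V') (S : Monad V) (T : Monad V') : Prop where
  functor_eq : S.toFunctor ⋙ H = H ⋙ T.toFunctor
  unit_eq (X : V) : HEq (H.map (S.η.app X)) (T.η.app (H.obj X))
  mul_eq (X : V) : HEq (H.map (S.μ.app X)) (T.μ.app (H.obj X))

/-- `H` strictly preserves the chosen finite products, exponentials and finite coproducts. -/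
structure IsStrictBicartesianClosed
    {V : Type u} [Category.{v} V] [CartesianMonoidalCategory V]
    {V' : Type u'} [Category.{v'} V'] [CartesianMonoidalCategory V']
    (P : BicartesianClosed V) (P' : BicartesianClosed V') (H : V ⥤ V') : Prop where
  unit_obj : H.obj (𝟙_ V) = 𝟙_ V'
  tensor_obj (A B : V) : H.obj (A ⊗ B) = H.obj A ⊗ H.obj B
  map_fst (A B : V) : HEq (H.map (fst A B)) (fst (H.obj A) (H.obj B))
  map_snd (A B : V) : HEq (H.map (snd A B)) (snd (H.obj A) (H.obj B))
  exp_obj (A B : V) : H.obj (P.exp A B) = P'.exp (H.obj A) (H.obj B)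
  map_ev (A B : V) : HEq (H.map (P.ev A B)) (P'.ev (H.obj A) (H.obj B))
  zero_obj : H.obj P.zero = P'.zero
  coprod_obj (A B : V) : H.obj (P.coprod A B) = P'.coprod (H.obj A) (H.obj B)
  map_inl (A B : V) : HEq (H.map (P.inl A B)) (P'.inl (H.obj A) (H.obj B))
  map_inr (A B : V) : HEq (H.map (P.inr A B)) (P'.inr (H.obj A) (H.obj B))

/-- `H` is a morphism of CBV pairs. -/
structure IsCBVPairMorphism
    {V : Type u} [Category.{v} V] [CartesianMonoidalCategory V]
    {V' : Type u'} [Category.{v'} V'] [CartesianMonoidalCategory V']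
    (P : BicartesianClosed V) (S : StrongMonad V)
    (P' : BicartesianClosed V') (T : StrongMonad V') (H : V ⥤ V') : Prop where
  strict : IsStrictBicartesianClosed P P' H
  lifts : LiftsMonad H S.toMonad T.toMonad

/-- The Kleisli category is ordered by the hom-orders of the base: `C(A, B) = V(A, T B)`. -/
instance kleisliHomOrder {V : Type u} [Category.{v} V] [OmegaCpoCategory V] (T : Monad V)
    (X Y : Kleisli T) : PartialOrder (X ⟶ Y) :=
  PartialOrder.lift (fun f : X ⟶ Y => f.of) fun _ _ h => Kleisli.hom_ext h

/-- An rCBV `ωCpo`-pair `(V, T)`, with all its chosen structure. -/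
structure RCBVPair {V : Type u} [Category.{v} V] [OmegaCpoCategory V]
    [CartesianMonoidalCategory V] (T : StrongMonad V) extends BicartesianClosed V where
  /-- chosen small `ωCpo`-colimits -/
  colim {J : Type v} [SmallCategory J] [OmegaCpoCategory J] (W : Jᵒᵖ ⥤ ωCPO.{v})
    [OmegaCpoWeight W] (K : J ⥤ V) [OmegaCpoFunctor K] : WeightedCocone W K
  colimIsColimit {J : Type v} [SmallCategory J] [OmegaCpoCategory J] (W : Jᵒᵖ ⥤ ωCPO.{v})
    [OmegaCpoWeight W] (K : J ⥤ V) [OmegaCpoFunctor K] : (colim W K).IsColimit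
  /-- the finite products are `ωCpo`-products (this is automatic for the terminal object) -/
  prod_le {X A B : V} (f g : X ⟶ A ⊗ B) :
    f ≫ fst A B ≤ g ≫ fst A B → f ≫ snd A B ≤ g ≫ snd A B → f ≤ g
  /-- `(B × -)` and `[B, -]` are `ωCpo`-functors, and form an `ωCpo`-adjunction -/
  tensor_omegaCpo (B : V) : OmegaCpoFunctor (tensorLeft B)
  ihom_omegaCpo (B : V) : OmegaCpoFunctor (toBicartesianClosed.ihomFunctor B)
  ihom_adj (B : V) : IsOmegaCpoAdjunction (toBicartesianClosed.ihomAdj B)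
  unit_full (A : V) : FullMorphism (T.η.app A)
  epZero : IsEpZero ((Kleisli.Adjunction.toKleisli T.toMonad).obj zero)
  lift_embedding {A B : V}
    (e : (Kleisli.Adjunction.toKleisli T.toMonad).obj A ⟶
      (Kleisli.Adjunction.toKleisli T.toMonad).obj B)
    (p : (Kleisli.Adjunction.toKleisli T.toMonad).obj B ⟶
      (Kleisli.Adjunction.toKleisli T.toMonad).obj A) :
    IsEpPair e p → ∃! f : A ⟶ B, (Kleisli.Adjunction.toKleisli T.toMonad).map f = e

/-- `H` is a morphism of rCBV `ωCpo`-pairs. -/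
structure IsRCBVPairMorphism
    {V : Type u} [Category.{v} V] [OmegaCpoCategory V] [CartesianMonoidalCategory V]
    {V' : Type u'} [Category.{v} V'] [OmegaCpoCategory V'] [CartesianMonoidalCategory V']
    {S : StrongMonad V} {T : StrongMonad V'} (P : RCBVPair S) (P' : RCBVPair T)
    (H : V ⥤ V') : Prop where
  omegaCpo : OmegaCpoFunctor H
  strict_colim {J : Type v} [SmallCategory J] [OmegaCpoCategory J] (W : Jᵒᵖ ⥤ ωCPO.{v})
    [OmegaCpoWeight W] (K : J ⥤ V) [OmegaCpoFunctor K] :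
    (P.colim W K).map H = P'.colim W (K ⋙ H)
  isCBVPairMorphism :
    IsCBVPairMorphism P.toBicartesianClosed S P'.toBicartesianClosed T H

/-! ### The scone and the subscone -/

section Scone

variable {V : Type u} [Category.{v} V] (G : V ⥤ ωCPO.{v})

/-- The scone along `G`, the comma category `ωCpo ↓ G`. -/
abbrev Scone := Comma (𝟭 ωCPO.{v}) G

/-- The objects `(D, C, j : D ⟶ G C)` of the scone with `j` a full morphism of `ωCpo`. -/
def IsSubsconeObj : ObjectProperty (Scone G) := fun X => FullMap (X.hom : X.left →𝒄 G.obj X.right)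

/-- The subscone along `G`. -/
abbrev Subscone := (IsSubsconeObj G).FullSubcategory

/-- The forgetful functor from the subscone to `V`, sending `(D, C, j)` to `C`. -/
abbrev Subscone.forget : Subscone G ⥤ V := (IsSubsconeObj G).ι ⋙ Comma.snd (𝟭 ωCPO.{v}) G

variable {G} [OmegaCpoCategory V]

/-- Morphisms of the scone are ordered componentwise. -/
instance sconeHomOrder (X Y : Scone G) : PartialOrder (X ⟶ Y) :=
  PartialOrder.lift
    (fun f : X ⟶ Y => ((f.left, f.right) : (X.left ⟶ Y.left) × (X.right ⟶ Y.right)))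
    fun f g h => by
      obtain ⟨h1, h2⟩ := Prod.mk.inj h
      exact CommaMorphism.ext h1 h2

/-- The two components of a morphism of the scone. -/
def sconeComponents (X Y : Scone G) :
    (X ⟶ Y) →o (X.left ⟶ Y.left) × (X.right ⟶ Y.right) where
  toFun f := (f.left, f.right)
  monotone' _ _ h := h

/-- Suprema of chains of morphisms of the scone are computed componentwise. -/
instance sconeHomOmega [OmegaCpoFunctor G] (X Y : Scone G) :
    OmegaCompletePartialOrder (X ⟶ Y) :=
  OmegaCompletePartialOrder.lift (sconeComponents X Y)
    (fun c =>
      { left := (ωSup (c.map (sconeComponents X Y))).1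
        right := (ωSup (c.map (sconeComponents X Y))).2
        w := by
          have h1 : ωScottContinuous
              (fun p : (X.left ⟶ Y.left) × (X.right ⟶ Y.right) =>
                (p.1 ≫ Y.hom : X.left ⟶ G.obj Y.right)) :=
            (OmegaCpoCategory.comp_continuous X.left Y.left (G.obj Y.right)).comp
              (Prod.ωScottContinuous.prodMk Prod.ωScottContinuous_fst (ωScottContinuous.const (x := Y.hom)))
          have h2 : ωScottContinuous
              (fun p : (X.left ⟶ Y.left) × (X.right ⟶ Y.right) =>
                (X.hom ≫ G.map p.2 : X.left ⟶ G.obj Y.right)) :=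
            (OmegaCpoCategory.comp_continuous X.left (G.obj X.right) (G.obj Y.right)).comp
              (Prod.ωScottContinuous.prodMk (ωScottContinuous.const (x := X.hom))
                ((OmegaCpoFunctor.map_continuous (F := G) X.right Y.right).comp
                  Prod.ωScottContinuous_snd))
          refine (h1.map_ωSup (c.map (sconeComponents X Y))).trans
            (Eq.trans ?_ (h2.map_ωSup (c.map (sconeComponents X Y))).symm)
          congr 1
          ext n : 2
          exact (c n).w })
    (fun _ _ h => h) (fun _ => rfl)

instance [OmegaCpoFunctor G] : OmegaCpoCategory (Scone G) where
  homOrder X Y := sconeHomOmega X Y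
  comp_continuous X Y Z := by
    refine ωScottContinuous.of_monotone_map_ωSup ⟨?_, fun c => ?_⟩
    · rintro ⟨f, g⟩ ⟨f', g'⟩ ⟨h, h'⟩
      exact ⟨(OmegaCpoCategory.comp_continuous X.left Y.left Z.left).monotone
          (show (f.left, g.left) ≤ (f'.left, g'.left) from ⟨h.1, h'.1⟩),
        (OmegaCpoCategory.comp_continuous X.right Y.right Z.right).monotone
          (show (f.right, g.right) ≤ (f'.right, g'.right) from ⟨h.2, h'.2⟩)⟩
    · refine CommaMorphism.ext ?_ ?_
      · exact (OmegaCpoCategory.comp_continuous X.left Y.left Z.left).map_ωSup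
          (c.map ⟨fun p => (p.1.left, p.2.left), fun p q h => ⟨h.1.1, h.2.1⟩⟩)
      · exact (OmegaCpoCategory.comp_continuous X.right Y.right Z.right).map_ωSup
          (c.map ⟨fun p => (p.1.right, p.2.right), fun p q h => ⟨h.1.2, h.2.2⟩⟩)

end Scone

/-- A full subcategory of an `ωCpo`-category, with the inherited order, is an `ωCpo`-category. -/
instance fullSubcategoryHomOrder {V : Type u} [Category.{v} V] [OmegaCpoCategory V]
    (P : ObjectProperty V) (X Y : P.FullSubcategory) : PartialOrder (X ⟶ Y) :=
  PartialOrder.lift (fun f : X ⟶ Y => f.hom) fun _ _ h => ObjectProperty.hom_ext P h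

instance fullSubcategoryHomOmega {V : Type u} [Category.{v} V] [OmegaCpoCategory V]
    (P : ObjectProperty V) (X Y : P.FullSubcategory) : OmegaCompletePartialOrder (X ⟶ Y) :=
  OmegaCompletePartialOrder.lift
    (⟨fun f => f.hom, fun _ _ h => h⟩ : (X ⟶ Y) →o (X.obj ⟶ Y.obj))
    (fun c => ObjectProperty.homMk (ωSup (c.map ⟨fun f => f.hom, fun _ _ h => h⟩)))
    (fun _ _ h => h) (fun _ => rfl)

instance {V : Type u} [Category.{v} V] [OmegaCpoCategory V] (P : ObjectProperty V) :
    OmegaCpoCategory P.FullSubcategory where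
  homOrder X Y := fullSubcategoryHomOmega P X Y
  comp_continuous X Y Z := by
    refine ωScottContinuous.of_monotone_map_ωSup ⟨?_, fun c => ?_⟩
    · rintro ⟨f, g⟩ ⟨f', g'⟩ ⟨h, h'⟩
      exact (OmegaCpoCategory.comp_continuous X.obj Y.obj Z.obj).monotone
        (show (f.hom, g.hom) ≤ (f'.hom, g'.hom) from ⟨h, h'⟩)
    · refine ObjectProperty.hom_ext P ?_
      exact (OmegaCpoCategory.comp_continuous X.obj Y.obj Z.obj).map_ωSup
        (c.map ⟨fun p => (p.1.hom, p.2.hom), fun p q h => ⟨h.1, h.2⟩⟩)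

/-! ### Chosen finite products of the subscone -/

/-- The chain of `c` lifted along a full map whose range contains `c`. -/
theorem FullMap.exists_ωSup {A B : ωCPO.{v}} {j : A →𝒄 B} (hj : FullMap j) (c : Chain B)
    (hc : ∀ i ∈ c, ∃ a, j a = i) : ∃ a, j a = ωSup c := by
  choose a ha using fun n => hc (c n) ⟨n, rfl⟩
  let d : Chain A := ⟨a, fun m n h => hj (by rw [ha, ha]; exact c.monotone h)⟩
  refine ⟨ωSup d, (j.continuous d).trans ?_⟩
  congr 1
  ext n : 2
  exact ha n

/-- A continuous map into `B` whose values lie in the range of the full map `j : A ⟶ B` factors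
through `j`. -/
noncomputable def FullMap.lift {A B D : ωCPO.{v}} {j : A →𝒄 B} (hj : FullMap j) (f : D →𝒄 B)
    (hf : ∀ x, ∃ a, j a = f x) : D →𝒄 A where
  toFun x := (hf x).choose
  monotone' x y h := hj (by
    rw [(hf x).choose_spec, (hf y).choose_spec]; exact f.monotone h)
  map_ωSup' c := by
    have hinj : ∀ x y, j x = j y → x = y := fun x y h =>
      le_antisymm (hj h.le) (hj h.ge)
    apply hinj
    refine (hf _).choose_spec.trans ((f.continuous c).trans (Eq.trans ?_ (j.continuous _).symm))
    congr 1
    ext n : 2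
    exact (hf (c n)).choose_spec.symm

theorem FullMap.lift_spec {A B D : ωCPO.{v}} {j : A →𝒄 B} (hj : FullMap j) (f : D →𝒄 B)
    (hf : ∀ x, ∃ a, j a = f x) (x : D) : j (hj.lift f hf x) = f x :=
  (hf x).choose_spec

theorem FullMap.injective {A B : ωCPO.{v}} {j : A →𝒄 B} (hj : FullMap j) :
    Function.Injective j := fun _ _ h => le_antisymm (hj h.le) (hj h.ge)

section Products

variable {V : Type u} [Category.{v} V] {G : V ⥤ ωCPO.{v}}

/-- The structure map `j : D ⟶ G C` of an object `(D, C, j)` of the subscone. -/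
def Subscone.arrow (X : Subscone G) : X.obj.left →𝒄 G.obj X.obj.right := X.obj.hom

theorem Subscone.arrow_full (X : Subscone G) : FullMap X.arrow := X.property

/-- The action of `G` on morphisms, as continuous maps. -/
def gmap (G : V ⥤ ωCPO.{v}) {A B : V} (f : A ⟶ B) : G.obj A →𝒄 G.obj B := G.map f

theorem gmap_comp {A B C : V} (f : A ⟶ B) (g : B ⟶ C) (x : G.obj A) :
    gmap G (f ≫ g) x = gmap G g (gmap G f x) :=
  congrArg (fun h : G.obj A →𝒄 G.obj C => h x) (G.map_comp f g)

/-- Constructor for objects of the subscone. -/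
def Subscone.mk {D : ωCPO.{v}} {C : V} (j : D →𝒄 G.obj C) (hj : FullMap j) : Subscone G :=
  ⟨{ left := D, right := C, hom := j }, hj⟩

/-- A morphism of the subscone is determined by its `V`-component `f`, and exists as soon as
`G f` carries the predicate on the source into the one on the target. -/
noncomputable def Subscone.homOf {X Y : Subscone G} (f : X.obj.right ⟶ Y.obj.right)
    (hf : ∀ x, ∃ y, Y.arrow y = gmap G f (X.arrow x)) : X ⟶ Y :=
  ObjectProperty.homMk
    { left := Y.arrow_full.lift ((gmap G f).comp X.arrow) hf
      right := f
      w := ContinuousHom.ext _ _ fun x =>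
        Y.arrow_full.lift_spec ((gmap G f).comp X.arrow) hf x }

theorem Subscone.arrow_left {X Y : Subscone G} (f : X ⟶ Y) (x : X.obj.left) :
    Y.arrow ((f.hom.left : X.obj.left →𝒄 Y.obj.left) x) = gmap G f.hom.right (X.arrow x) :=
  congrArg (fun h : X.obj.left →𝒄 G.obj Y.obj.right => h x) f.hom.w

theorem Subscone.hom_ext {X Y : Subscone G} {f g : X ⟶ Y} (h : f.hom.right = g.hom.right) :
    f = g := by
  refine ObjectProperty.hom_ext _ (CommaMorphism.ext ?_ h)
  refine ContinuousHom.ext _ _ fun x => Y.arrow_full.injective ?_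
  refine (arrow_left f x).trans (Eq.trans ?_ (arrow_left g x).symm)
  rw [h]

/-- The object `(∅, C, !)`. For `C` initial this is the initial object `(0, 0, !)`. -/
def Subscone.bot (G : V ⥤ ωCPO.{v}) (C : V) : Subscone G :=
  letI : OmegaCompletePartialOrder PEmpty.{v + 1} :=
    { ωSup := fun c => c 0
      le_ωSup := fun c => (c 0).elim
      ωSup_le := fun c => (c 0).elim }
  Subscone.mk (D := ωCPO.of PEmpty.{v + 1}) (C := C)
    { toFun := fun x => x.elim
      monotone' := fun x => x.elim
      map_ωSup' := fun c => (c 0).elim } (fun x => x.elim)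

variable [CartesianMonoidalCategory V]

/-- The terminal object `(G 1, 1, id)` of the subscone. -/
def Subscone.unit (G : V ⥤ ωCPO.{v}) : Subscone G :=
  Subscone.mk (C := 𝟙_ V) (ContinuousHom.id : G.obj (𝟙_ V) →𝒄 G.obj (𝟙_ V)) fun _ _ h => h

/-- The predicate on `G (C × C')` of the elements whose two projections satisfy the predicates
`X` and `Y`. -/
def Subscone.prodPred (X Y : Subscone G) (z : G.obj (X.obj.right ⊗ Y.obj.right)) : Prop :=
  (∃ x, X.arrow x = gmap G (fst _ _) z) ∧ ∃ y, Y.arrow y = gmap G (snd _ _) z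

/-- The binary product of the subscone, over the chosen product of `V`. -/
def Subscone.prod (X Y : Subscone G) : Subscone G :=
  letI : OmegaCompletePartialOrder (Subtype (Subscone.prodPred X Y)) :=
    OmegaCompletePartialOrder.subtype _ fun c hc => by
      constructor
      · obtain ⟨x, hx⟩ := X.arrow_full.exists_ωSup (c.map (gmap G (fst _ _)).toOrderHom) (by
          rintro _ ⟨n, rfl⟩
          exact (hc (c n) ⟨n, rfl⟩).1)
        exact ⟨x, hx.trans ((gmap G (fst _ _)).continuous c).symm⟩
      · obtain ⟨x, hx⟩ := Y.arrow_full.exists_ωSup (c.map (gmap G (snd _ _)).toOrderHom) (by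
          rintro _ ⟨n, rfl⟩
          exact (hc (c n) ⟨n, rfl⟩).2)
        exact ⟨x, hx.trans ((gmap G (snd _ _)).continuous c).symm⟩
  Subscone.mk (D := ωCPO.of (Subtype (Subscone.prodPred X Y))) (C := X.obj.right ⊗ Y.obj.right)
    { toFun := Subtype.val
      monotone' := fun _ _ h => h
      map_ωSup' := fun _ => rfl } (fun _ _ h => h)

/-- First projection. -/
noncomputable def Subscone.prodFst (X Y : Subscone G) : X.prod Y ⟶ X :=
  Subscone.homOf (fst X.obj.right Y.obj.right) fun z => z.2.1

/-- Second projection. -/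
noncomputable def Subscone.prodSnd (X Y : Subscone G) : X.prod Y ⟶ Y :=
  Subscone.homOf (snd X.obj.right Y.obj.right) fun z => z.2.2

/-- Pairing. -/
noncomputable def Subscone.prodLift {X Y Z : Subscone G} (f : Z ⟶ X) (g : Z ⟶ Y) :
    Z ⟶ X.prod Y :=
  Subscone.homOf (lift f.hom.right g.hom.right) fun z =>
    ⟨⟨gmap G (lift f.hom.right g.hom.right) (Z.arrow z),
      ⟨(f.hom.left : Z.obj.left →𝒄 X.obj.left) z, by
        rw [arrow_left, ← gmap_comp, lift_fst]⟩,
      ⟨(g.hom.left : Z.obj.left →𝒄 Y.obj.left) z, by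
        rw [arrow_left, ← gmap_comp, lift_snd]⟩⟩, rfl⟩

/-- The chosen finite products of the subscone, lying strictly over those of `V`. -/
noncomputable instance : CartesianMonoidalCategory (Subscone G) :=
  CartesianMonoidalCategory.ofChosenFiniteProducts
    ⟨asEmptyCone (Subscone.unit G),
      IsTerminal.ofUniqueHom
        (fun X => Subscone.homOf (toUnit X.obj.right) fun _ => ⟨_, rfl⟩)
        fun X f => Subscone.hom_ext (toUnit_unique _ _)⟩
    fun X Y => ⟨BinaryFan.mk (X.prodFst Y) (X.prodSnd Y),
      BinaryFan.IsLimit.mk _ (fun f g => Subscone.prodLift f g)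
        (fun f g => Subscone.hom_ext (lift_fst _ _))
        (fun f g => Subscone.hom_ext (lift_snd _ _))
        (fun f g m h1 h2 => Subscone.hom_ext (by
          refine CartesianMonoidalCategory.hom_ext _ _ ?_ ?_
          · exact (congrArg (fun k => k.hom.right) h1).trans (lift_fst _ _).symm
          · exact (congrArg (fun k => k.hom.right) h2).trans (lift_snd _ _).symm))⟩

end Products

/-- The square in `ωCpo`, with left and right sides the structure maps of `X` and `Y`, induced by
a morphism `f : X ⟶ Y` of the subscone is a pullback. -/
def IsPullbackHom {V : Type u} [Category.{v} V] {G : V ⥤ ωCPO.{v}}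
    {X Y : Subscone G} (f : X ⟶ Y) : Prop :=
  IsPullback (C := ωCPO.{v}) f.hom.left X.obj.hom Y.obj.hom (G.map f.hom.right)

end OmegaCpo

/-! A full map `j : D → G C` is injective and reflects the order, and its range is closed under
suprema of ω-chains. Up to isomorphism an object of the subscone is thus an object `C` of `V` with a
chain-closed predicate on `G C`, and a morphism is a morphism `f` of `V` for which `G f` respects
the predicates. The first component of a morphism and the order between parallel morphisms are
determined by the component in `V` (`hom_ext`, `le_iff`). Hence equations, inequalities and suprema
are all tested in `V`, and each construction only needs the right predicate over the chosen
structure of `V`; this is also why the forgetful functor is strict.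

For colimits and coproducts the predicate is the least chain-closed one containing the images of the
given predicates. For exponentials it is that of logical relations: a function is accepted when it
sends accepted arguments to accepted values. This needs pairs in `G (A × B)`, ordered by their
projections, and they exist because `G` is a right `ωCpo`-adjoint (`preservesPairs`).

The lifting of monads induces a functor of Kleisli categories that preserves and reflects the order,
so it preserves and reflects ep-pairs, and fullness of the unit is inherited. Condition (B) makes
the initial object a zero object in the Kleisli category, and its ep-pairs come from those of `V`.
For an embedding `e`, the pair below gives a unique `f` in `V`; condition (A) says exactly that `f`
respects the predicates, because its composite with the unit does (`existsUnique_toKleisli_map`). -/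

namespace OmegaCpo

/-! ### Chain-closed predicates and the objects of the subscone they define -/

/-- A predicate on an `ω`-cpo that is closed under suprema of `ω`-chains. -/
def ChainClosed {B : ωCPO.{v}} (S : B → Prop) : Prop :=
  ∀ c : Chain B, (∀ n, S (c n)) → S (ωSup c)

theorem ChainClosed.preimage {A B : ωCPO.{v}} {S : B → Prop} (hS : ChainClosed S) (f : A →𝒄 B) :
    ChainClosed fun a => S (f a) := fun c hc => by
  change S (f (ωSup c))
  rw [f.continuous c]
  exact hS _ hc

/-- The least chain-closed predicate containing `S`. -/
def chainClosure {B : ωCPO.{v}} (S : B → Prop) (b : B) : Prop :=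
  ∀ R : B → Prop, ChainClosed R → (∀ x, S x → R x) → R b

theorem chainClosed_chainClosure {B : ωCPO.{v}} (S : B → Prop) : ChainClosed (chainClosure S) :=
  fun c hc R hR hS => hR c fun n => hc n R hR hS

theorem subset_chainClosure {B : ωCPO.{v}} {S : B → Prop} {b : B} (hb : S b) :
    chainClosure S b := fun _ _ hS => hS b hb

/-- The continuous map from the one-point `ω`-cpo with value `b`. -/
def pointHom (B : ωCPO.{v}) (b : B) : ωCPO.of PUnit.{v + 1} →𝒄 B := ContinuousHom.const b

namespace Subscone

section

variable {V : Type u} [Category.{v} V] {G : V ⥤ ωCPO.{v}}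

/-- The predicate on `G C` defined by an object `(D, C, j)` of the subscone: the range of `j`. -/
def pred (X : Subscone G) (z : G.obj X.obj.right) : Prop := ∃ x, X.arrow x = z

theorem pred_chainClosed (X : Subscone G) : ChainClosed X.pred := fun c hc =>
  X.arrow_full.exists_ωSup c (by rintro _ ⟨n, rfl⟩; exact hc n)

theorem pred_map {X Y : Subscone G} (f : X ⟶ Y) {z : G.obj X.obj.right} (hz : X.pred z) :
    Y.pred (gmap G f.hom.right z) := by
  obtain ⟨x, rfl⟩ := hz
  exact ⟨_, arrow_left f x⟩

/-- The object of the subscone over `C` given by a chain-closed predicate on `G C`. -/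
def ofPred {C : V} (S : G.obj C → Prop) (hS : ChainClosed S) : Subscone G :=
  letI : OmegaCompletePartialOrder (Subtype S) :=
    OmegaCompletePartialOrder.subtype _ fun c hc => hS c fun n => hc _ ⟨n, rfl⟩
  Subscone.mk (D := ωCPO.of (Subtype S)) (C := C)
    { toFun := Subtype.val
      monotone' := fun _ _ h => h
      map_ωSup' := fun _ => rfl } (fun _ _ h => h)

theorem pred_ofPred {C : V} {S : G.obj C → Prop} {hS : ChainClosed S} {z : G.obj C} :
    (ofPred S hS).pred z ↔ S z :=
  ⟨fun ⟨x, hx⟩ => hx ▸ x.2, fun h => ⟨⟨z, h⟩, rfl⟩⟩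

/-- Every morphism of `V` that respects the predicates underlies a morphism of the subscone. -/
noncomputable def homOfPred {X Y : Subscone G} (f : X.obj.right ⟶ Y.obj.right)
    (hf : ∀ z, X.pred z → Y.pred (gmap G f z)) : X ⟶ Y :=
  homOf f fun x => hf _ ⟨x, rfl⟩

/-- A morphism out of the object given by a chain closure need only respect the generators. -/
noncomputable def homOfClosure {C : V} (S : G.obj C → Prop) {Y : Subscone G}
    (f : C ⟶ Y.obj.right) (hf : ∀ z, S z → Y.pred (gmap G f z)) :
    ofPred _ (chainClosed_chainClosure S) ⟶ Y :=
  homOfPred f fun _ hz =>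
    -- The closure is an intersection, so it is eliminated at one chain-closed predicate: the
    -- pullback of `Y.pred` along `G f`.
    pred_ofPred.1 hz _ (Y.pred_chainClosed.preimage (gmap G f)) hf

/-- Elements are maps out of the one-point ω-cpo, so `z` and a witness for its image form a cone
over the square; the induced map names the required element of `X`. This is the form in which
condition (A) is used. -/
theorem pred_of_isPullbackHom {X Y : Subscone G} {f : X ⟶ Y} (hf : IsPullbackHom f)
    {z : G.obj X.obj.right} (hz : Y.pred (gmap G f.hom.right z)) : X.pred z := by
  obtain ⟨y, hy⟩ := hz
  obtain ⟨l, -, hl⟩ := hf.exists_lift (W := ωCPO.of PUnit.{v + 1})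
    (pointHom _ y) (pointHom _ z) (ContinuousHom.ext _ _ fun _ => hy)
  exact ⟨(l : ωCPO.of PUnit.{v + 1} →𝒄 X.obj.left) PUnit.unit,
    congrArg (fun h : ωCPO.of PUnit.{v + 1} →𝒄 G.obj X.obj.right => h PUnit.unit) hl⟩

end

/-! ### Order and suprema of morphisms, detected in `V` -/

section Order

variable {V : Type u} [Category.{v} V] [OmegaCpoCategory V] {G : V ⥤ ωCPO.{v}}
  [OmegaCpoFunctor G]

/-- The left components, followed by the full map `Y.arrow`, become `G` of the right components
after `X.arrow`; `G` is monotone on homs and `Y.arrow` reflects the order. -/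
theorem le_iff {X Y : Subscone G} {f g : X ⟶ Y} : f ≤ g ↔ f.hom.right ≤ g.hom.right := by
  refine ⟨fun h => And.right h, fun h => ⟨fun x => Y.arrow_full ?_, h⟩⟩
  have hle := (OmegaCpoFunctor.map_continuous (F := G) _ _).monotone h (X.arrow x)
  exact (arrow_left f x).le.trans (hle.trans (arrow_left g x).ge)

theorem continuous_right (X Y : Subscone G) :
    ωScottContinuous fun f : X ⟶ Y => f.hom.right :=
  ωScottContinuous.of_monotone_map_ωSup ⟨fun _ _ h => le_iff.1 h, fun _ => rfl⟩

/-- Suprema of morphisms are computed componentwise and the right component determines the rest, so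
continuity may be checked there. -/
theorem continuous_of_right {α : Type*} [OmegaCompletePartialOrder α] {X Y : Subscone G}
    {f : α → (X ⟶ Y)} (hf : ωScottContinuous fun a => (f a).hom.right) : ωScottContinuous f :=
  ωScottContinuous.of_monotone_map_ωSup
    ⟨fun _ _ h => le_iff.2 (hf.monotone h), fun c => hom_ext (hf.map_ωSup c)⟩

instance : OmegaCpoFunctor (Subscone.forget G) where
  map_continuous X Y := continuous_right X Y

/-! ### Weighted colimits of the subscone -/

section Colimits

variable {J : Type v} [SmallCategory J] {W : Jᵒᵖ ⥤ ωCPO.{v}} {K : J ⥤ Subscone G}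
  (c : WeightedCocone W (K ⋙ forget G))

/-- The elements of `G c.pt` coming from the predicates of a diagram in the subscone. -/
def coconePred (z : G.obj c.pt) : Prop :=
  ∃ (j : J) (w : W.obj (op j)) (d : G.obj (K.obj j).obj.right),
    (K.obj j).pred d ∧ gmap G (c.leg j w) d = z

/-- The lifting to the subscone of a weighted cocone on the underlying diagram in `V`. -/
noncomputable def liftCocone : WeightedCocone W K where
  pt := ofPred _ (chainClosed_chainClosure (coconePred c))
  leg j := ContinuousHom.ofFun
    (fun w => homOfPred (c.leg j w)
      fun d hd => pred_ofPred.2 (subset_chainClosure ⟨j, w, d, hd, rfl⟩))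
    (continuous_of_right (c.leg j).ωScottContinuous)
  naturality f w := hom_ext (c.naturality f w)

/-- Only the predicate is new: vertex and legs are the given ones, so colimits are preserved on the
nose. -/
theorem liftCocone_map : (liftCocone c).map (forget G) = c := rfl

/-- The factorization in `V` respects the predicates because it does so on the generators of the
closure, where it agrees with the legs of `s`. -/
theorem liftCocone_isColimit (hc : c.IsColimit) : (liftCocone c).IsColimit where
  exists_fac s := by
    obtain ⟨h, hh⟩ : ∃ h : c.pt ⟶ s.pt.obj.right, ∀ j w, c.leg j w ≫ h = (s.leg j w).hom.right :=
      hc.exists_fac (s.map (forget G))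
    refine ⟨homOfClosure (coconePred c) h ?_, fun j w => hom_ext (hh j w)⟩
    rintro _ ⟨j, w, d, hd, rfl⟩
    rw [← gmap_comp, hh]
    exact pred_map (s.leg j w) hd
  le_of_legs f g h := le_iff.2 (hc.le_of_legs _ _ fun j w => le_iff.1 (h j w))

end Colimits

end Order

/-! ### Finite coproducts of the subscone -/

section Coproducts

variable {V : Type u} [Category.{v} V] {G : V ⥤ ωCPO.{v}}

/-- The object over the initial object with empty predicate is initial. -/
noncomputable def botIsInitial {Z : V} (hZ : IsInitial Z) : IsInitial (Subscone.bot G Z) :=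
  IsInitial.ofUniqueHom (fun X => homOf (hZ.to X.obj.right) fun x => x.elim)
    fun _ _ => hom_ext (hZ.hom_ext _ _)

variable {X Y : Subscone G} {C : V} (l : X.obj.right ⟶ C) (r : Y.obj.right ⟶ C)

/-- The elements of `G C` coming from the predicates of `X` and `Y`. -/
def coprodPred (z : G.obj C) : Prop :=
  (∃ x, X.pred x ∧ gmap G l x = z) ∨ ∃ y, Y.pred y ∧ gmap G r y = z

/-- The binary coproduct of the subscone over a coproduct `C` in `V`. -/
def coprodObj : Subscone G := ofPred _ (chainClosed_chainClosure (coprodPred l r))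

/-- First coprojection. -/
noncomputable def coprodInl : X ⟶ coprodObj l r :=
  homOfPred l fun x hx => pred_ofPred.2 (subset_chainClosure (.inl ⟨x, hx, rfl⟩))

/-- Second coprojection. -/
noncomputable def coprodInr : Y ⟶ coprodObj l r :=
  homOfPred r fun y hy => pred_ofPred.2 (subset_chainClosure (.inr ⟨y, hy, rfl⟩))

/-- Copairing. -/
noncomputable def coprodDesc {Z : Subscone G} (f : X ⟶ Z) (g : Y ⟶ Z) (h : C ⟶ Z.obj.right)
    (hl : l ≫ h = f.hom.right) (hr : r ≫ h = g.hom.right) : coprodObj l r ⟶ Z :=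
  homOfClosure (coprodPred l r) h <| by
    rintro _ (⟨x, hx, rfl⟩ | ⟨y, hy, rfl⟩)
    · rw [← gmap_comp, hl]
      exact pred_map f hx
    · rw [← gmap_comp, hr]
      exact pred_map g hy

/-- The lifting of a coproduct in `V` is a coproduct in the subscone. -/
noncomputable def coprodIsColimit (hc : IsColimit (BinaryCofan.mk l r)) :
    IsColimit (BinaryCofan.mk (coprodInl l r) (coprodInr l r)) :=
  BinaryCofan.IsColimit.mk _
    (fun f g => coprodDesc l r f g
      (hc.desc (BinaryCofan.mk f.hom.right g.hom.right))
      (hc.fac (BinaryCofan.mk f.hom.right g.hom.right) ⟨WalkingPair.left⟩)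
      (hc.fac (BinaryCofan.mk f.hom.right g.hom.right) ⟨WalkingPair.right⟩))
    (fun f g => hom_ext (hc.fac (BinaryCofan.mk f.hom.right g.hom.right) ⟨WalkingPair.left⟩))
    (fun f g => hom_ext (hc.fac (BinaryCofan.mk f.hom.right g.hom.right) ⟨WalkingPair.right⟩))
    (fun f g _ h1 h2 => hom_ext (BinaryCofan.IsColimit.hom_ext hc
      ((congrArg (fun k => k.hom.right) h1).trans
        (hc.fac (BinaryCofan.mk f.hom.right g.hom.right) ⟨WalkingPair.left⟩).symm)
      ((congrArg (fun k => k.hom.right) h2).trans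
        (hc.fac (BinaryCofan.mk f.hom.right g.hom.right) ⟨WalkingPair.right⟩).symm)))

end Coproducts

end Subscone

/-! ### Exponentials of the subscone -/

/-! ### Elements of `G C` as morphisms out of the free object on one point -/

namespace IsOmegaCpoAdjunction

variable {V : Type u} [Category.{v} V] {G : V ⥤ ωCPO.{v}} {F : ωCPO.{v} ⥤ V}

/-- The element of `G C` named by a morphism from the free object on one point. -/
def element (adj : F ⊣ G) {C : V} (f : F.obj (ωCPO.of PUnit.{v + 1}) ⟶ C) : G.obj C :=
  (adj.homEquiv _ C f : ωCPO.of PUnit.{v + 1} →𝒄 G.obj C) PUnit.unit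

theorem element_surjective (adj : F ⊣ G) {C : V} (z : G.obj C) :
    ∃ f, element adj f = z := by
  refine ⟨(adj.homEquiv _ C).symm (pointHom _ z), ?_⟩
  unfold element
  rw [Equiv.apply_symm_apply]
  rfl

theorem element_comp (adj : F ⊣ G) {C C' : V} (f : F.obj (ωCPO.of PUnit.{v + 1}) ⟶ C)
    (g : C ⟶ C') : element adj (f ≫ g) = gmap G g (element adj f) :=
  congrArg (fun h : ωCPO.of PUnit.{v + 1} →𝒄 G.obj C' => h PUnit.unit)
    (adj.homEquiv_naturality_right f g)

theorem element_le_iff [OmegaCpoCategory V] {adj : F ⊣ G} (h : IsOmegaCpoAdjunction adj) {C : V}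
    {f g : F.obj (ωCPO.of PUnit.{v + 1}) ⟶ C} : element adj f ≤ element adj g ↔ f ≤ g :=
  ⟨fun hle => (h _ _ f g).1 fun _ => hle, fun hle => (h _ _ f g).2 hle PUnit.unit⟩

end IsOmegaCpoAdjunction

/-- The functor `G` has order-theoretic binary products: pairs exist in `G (A × B)`, and the order
of `G (A × B)` is reflected by the two projections. -/
structure PreservesPairs {V : Type u} [Category.{v} V] [CartesianMonoidalCategory V]
    (G : V ⥤ ωCPO.{v}) : Prop where
  le_of_proj {A B : V} {z w : G.obj (A ⊗ B)} :
    gmap G (fst A B) z ≤ gmap G (fst A B) w → gmap G (snd A B) z ≤ gmap G (snd A B) w → z ≤ w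
  exists_pair {A B : V} (a : G.obj A) (b : G.obj B) :
    ∃ z : G.obj (A ⊗ B), gmap G (fst A B) z = a ∧ gmap G (snd A B) z = b

theorem PreservesPairs.ext {V : Type u} [Category.{v} V] [CartesianMonoidalCategory V]
    {G : V ⥤ ωCPO.{v}} (hG : PreservesPairs G) {A B : V} {z w : G.obj (A ⊗ B)}
    (h1 : gmap G (fst A B) z = gmap G (fst A B) w)
    (h2 : gmap G (snd A B) z = gmap G (snd A B) w) : z = w :=
  le_antisymm (hG.le_of_proj h1.le h2.le) (hG.le_of_proj h1.ge h2.ge)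

open IsOmegaCpoAdjunction in
/-- Right `ωCpo`-adjoints preserve finite `ωCpo`-products. -/
theorem IsRightOmegaCpoAdjoint.preservesPairs {V : Type u} [Category.{v} V] [OmegaCpoCategory V]
    [CartesianMonoidalCategory V] {G : V ⥤ ωCPO.{v}} [OmegaCpoFunctor G]
    (hG : IsRightOmegaCpoAdjoint G)
    (hV : ∀ {X A B : V} (f g : X ⟶ A ⊗ B),
      f ≫ fst A B ≤ g ≫ fst A B → f ≫ snd A B ≤ g ≫ snd A B → f ≤ g) : PreservesPairs G := by
  obtain ⟨F, adj, -, hadj⟩ := hG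
  -- Elements of `G (A × B)` are replaced by morphisms of `V` out of `F 1`; both claims then become
  -- properties of the product in `V`.
  refine ⟨fun {A B z w} h1 h2 => ?_, fun a b => ?_⟩
  · obtain ⟨f, rfl⟩ := element_surjective adj z
    obtain ⟨g, rfl⟩ := element_surjective adj w
    rw [← element_comp, ← element_comp, element_le_iff hadj] at h1 h2
    exact (element_le_iff hadj).2 (hV f g h1 h2)
  · obtain ⟨f, rfl⟩ := element_surjective adj a
    obtain ⟨g, rfl⟩ := element_surjective adj b
    exact ⟨element adj (lift f g), by rw [← element_comp, lift_fst],
      by rw [← element_comp, lift_snd]⟩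

theorem whiskerLeft_homEquiv_counit {V : Type u} [Category.{v} V] [MonoidalCategory V] {A B C : V}
    {R : V ⥤ V} (adj : tensorLeft A ⊣ R) (f : A ⊗ B ⟶ C) :
    A ◁ adj.homEquiv B C f ≫ adj.counit.app C = f :=
  (adj.homEquiv_counit B C (adj.homEquiv B C f)).symm.trans (Equiv.symm_apply_apply _ f)

/-! ### Logical-relations predicate on exponentials and its adjunction -/

namespace Subscone

variable {V : Type u} [Category.{v} V] [CartesianMonoidalCategory V] {G : V ⥤ ωCPO.{v}}

theorem right_whiskerLeft (X : Subscone G) {Y Z : Subscone G} (f : Y ⟶ Z) :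
    (X ◁ f).hom.right = X.obj.right ◁ f.hom.right := by
  refine CartesianMonoidalCategory.hom_ext _ _ ?_ ?_
  · refine (congrArg (fun k => k.hom.right) (whiskerLeft_fst X f)).trans ?_
    exact (whiskerLeft_fst _ _).symm
  · refine (congrArg (fun k => k.hom.right) (whiskerLeft_snd X f)).trans ?_
    exact (whiskerLeft_snd _ _).symm

theorem pred_tensor {X Y : Subscone G} {z : G.obj (X.obj.right ⊗ Y.obj.right)} :
    (X ⊗ Y).pred z ↔ X.pred (gmap G (fst _ _) z) ∧ Y.pred (gmap G (snd _ _) z) :=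
  ⟨fun ⟨x, hx⟩ => hx ▸ x.2, fun h => ⟨⟨z, h⟩, rfl⟩⟩

variable {R : V → V ⥤ V} (adj : ∀ A, tensorLeft A ⊣ R A)

/-- The elements of `G [X, Y]` that carry elements of `X` to elements of `Y`. -/
def expPred (X Y : Subscone G) (z : G.obj ((R X.obj.right).obj Y.obj.right)) : Prop :=
  ∀ w : G.obj (X.obj.right ⊗ (R X.obj.right).obj Y.obj.right),
    X.pred (gmap G (fst _ _) w) → gmap G (snd _ _) w = z →
      Y.pred (gmap G ((adj X.obj.right).counit.app Y.obj.right) w)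

/-- For a fixed accepted argument, pairing it with the terms of the chain gives a chain of pairs
whose supremum is the pair to be tested. Evaluation is continuous and the target predicate is
chain-closed. -/
theorem expPred_chainClosed (hG : PreservesPairs G) (X Y : Subscone G) :
    ChainClosed (expPred adj X Y) := by
  intro c hc w hw1 hw2
  choose p hp1 hp2 using fun n => hG.exists_pair (gmap G (fst _ _) w) (c n)
  let d : Chain (G.obj (X.obj.right ⊗ (R X.obj.right).obj Y.obj.right)) :=
    ⟨p, fun m n h => hG.le_of_proj (by rw [hp1, hp1])
      (by rw [hp2, hp2]; exact c.monotone h)⟩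
  have h1 : gmap G (fst _ _) (ωSup d) = gmap G (fst _ _) w := by
    rw [(gmap G (fst _ _)).continuous d]
    exact le_antisymm (ωSup_le _ _ fun n => (hp1 n).le)
      -- The chain of first projections is constant, so its zeroth term already bounds the value
      -- from below.
      ((hp1 0).ge.trans (le_ωSup (d.map (gmap G (fst _ _)).toOrderHom) 0))
  have h2 : gmap G (snd _ _) (ωSup d) = gmap G (snd _ _) w := by
    rw [(gmap G (snd _ _)).continuous d, hw2]
    congr 1
    ext n : 2
    exact hp2 n
  rw [← hG.ext h1 h2]
  exact Y.pred_chainClosed.preimage (gmap G _) d fun n =>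
    hc n (p n) ((hp1 n).symm ▸ hw1) (hp2 n)

/-- The exponential of the subscone. -/
def expObj (hG : PreservesPairs G) (X Y : Subscone G) : Subscone G :=
  ofPred _ (expPred_chainClosed adj hG X Y)

/-- A test pair `w` over the transpose applied to `y` is the image of the pair `p` of its argument
with `y`, so evaluating it amounts to applying `f` to `p`. -/
theorem expPred_homEquiv (hG : PreservesPairs G) {X Y Z : Subscone G}
    {f : X.obj.right ⊗ Y.obj.right ⟶ Z.obj.right}
    (hf : ∀ p, (X ⊗ Y).pred p → Z.pred (gmap G f p)) {y : G.obj Y.obj.right} (hy : Y.pred y) :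
    expPred adj X Z (gmap G ((adj X.obj.right).homEquiv Y.obj.right Z.obj.right f) y) := by
  intro w hw1 hw2
  obtain ⟨p, hp1, hp2⟩ := hG.exists_pair (gmap G (fst _ _) w) y
  have hp : gmap G (X.obj.right ◁ (adj X.obj.right).homEquiv Y.obj.right Z.obj.right f) p = w := by
    apply hG.ext
    · rw [← gmap_comp, whiskerLeft_fst, hp1]
    · rw [← gmap_comp, whiskerLeft_snd, gmap_comp, hp2, hw2]
  rw [← hp, ← gmap_comp, whiskerLeft_homEquiv_counit]
  exact hf p (pred_tensor.2 ⟨hp1.symm ▸ hw1, hp2.symm ▸ hy⟩)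

/-- The inverse transpose is evaluation after `X ◁ g`, so the image of `p` under `X ◁ g` serves as
the test pair. -/
theorem pred_homEquiv_symm {X Y Z : Subscone G}
    {g : Y.obj.right ⟶ (R X.obj.right).obj Z.obj.right}
    (hg : ∀ y, Y.pred y → expPred adj X Z (gmap G g y))
    {p : G.obj (X.obj.right ⊗ Y.obj.right)} (hp : (X ⊗ Y).pred p) :
    Z.pred (gmap G (((adj X.obj.right).homEquiv Y.obj.right Z.obj.right).symm g) p) := by
  obtain ⟨hp1, hp2⟩ := pred_tensor.1 hp
  rw [(adj X.obj.right).homEquiv_counit, curriedTensor_obj_map, gmap_comp]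
  refine hg _ hp2 _ ?_ ?_
  · rw [← gmap_comp, whiskerLeft_fst]
    exact hp1
  · rw [← gmap_comp, whiskerLeft_snd, gmap_comp]

/-- The transposition of morphisms of the subscone. -/
noncomputable def expEquiv (hG : PreservesPairs G) (X Y Z : Subscone G) :
    ((tensorLeft X).obj Y ⟶ Z) ≃ (Y ⟶ expObj adj hG X Z) where
  toFun f := homOfPred ((adj X.obj.right).homEquiv Y.obj.right Z.obj.right f.hom.right)
    fun _ hy => pred_ofPred.2 (expPred_homEquiv adj hG (fun _ => pred_map f) hy)
  invFun g := homOfPred (((adj X.obj.right).homEquiv Y.obj.right Z.obj.right).symm g.hom.right)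
    fun _ => pred_homEquiv_symm adj fun _ hy => pred_ofPred.1 (pred_map g hy)
  left_inv _ := hom_ext (Equiv.symm_apply_apply _ _)
  right_inv _ := hom_ext (Equiv.apply_symm_apply _ _)

theorem right_expEquiv (hG : PreservesPairs G) {X Y Z : Subscone G}
    (f : (tensorLeft X).obj Y ⟶ Z) : (expEquiv adj hG X Y Z f).hom.right =
      (adj X.obj.right).homEquiv Y.obj.right Z.obj.right f.hom.right := rfl

theorem expEquiv_naturality (hG : PreservesPairs G) (X Y' Y Z : Subscone G) (f : Y' ⟶ Y)
    (g : (tensorLeft X).obj Y ⟶ Z) :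
    expEquiv adj hG X Y' Z ((tensorLeft X).map f ≫ g) = f ≫ expEquiv adj hG X Y Z g := by
  refine hom_ext ?_
  rw [right_expEquiv]
  change (adj X.obj.right).homEquiv _ _ ((X ◁ f).hom.right ≫ g.hom.right) =
    f.hom.right ≫ (adj X.obj.right).homEquiv _ _ g.hom.right
  rw [right_whiskerLeft]
  exact (adj X.obj.right).homEquiv_naturality_left _ _

/-- The exponentials of the subscone as a functor. -/
noncomputable def expFunctor (hG : PreservesPairs G) (X : Subscone G) : Subscone G ⥤ Subscone G :=
  Adjunction.rightAdjointOfEquiv (expEquiv adj hG X) (expEquiv_naturality adj hG X)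

/-- The exponentials of the subscone are right adjoint to the products. -/
noncomputable def expAdj (hG : PreservesPairs G) (X : Subscone G) :
    tensorLeft X ⊣ expFunctor adj hG X :=
  Adjunction.adjunctionOfEquivRight (expEquiv adj hG X) (expEquiv_naturality adj hG X)

theorem right_expFunctor_map (hG : PreservesPairs G) (X : Subscone G) {Y Z : Subscone G}
    (f : Y ⟶ Z) : ((expFunctor adj hG X).map f).hom.right =
      (R X.obj.right).map f.hom.right := by
  -- The right adjoint acts on `f` by transposing evaluation followed by `f`, evaluation being the
  -- inverse transpose of the identity.
  change (adj X.obj.right).homEquiv _ _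
    (((adj X.obj.right).homEquiv _ _).symm (𝟙 _) ≫ f.hom.right) = _
  rw [Adjunction.homEquiv_naturality_right, Equiv.apply_symm_apply]
  exact Category.id_comp _

theorem expAdj_homEquiv (hG : PreservesPairs G) (X Y Z : Subscone G) :
    (expAdj adj hG X).homEquiv Y Z = expEquiv adj hG X Y Z :=
  congrFun (congrFun (Adjunction.mkOfHomEquiv_homEquiv _) Y) Z

/-- Both evaluations are inverse transposes of identities. This yields strict preservation of
evaluation. -/
theorem right_expAdj_counit (hG : PreservesPairs G) (X Y : Subscone G) :
    ((expAdj adj hG X).counit.app Y).hom.right =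
      (adj X.obj.right).counit.app Y.obj.right := by
  rw [← Adjunction.homEquiv_symm_id, expAdj_homEquiv]
  exact (adj X.obj.right).homEquiv_symm_id _

end Subscone

/-! ### Liftings of monads and Kleisli categories -/

/-- Strictness of a lifting is stated by heterogeneous equality; composing with a transport of the
codomain makes it an equation that can be used inside composites. -/
theorem comp_eqToHom_of_heq {V : Type u} [Category.{v} V] {A B B' : V} {f : A ⟶ B} {g : A ⟶ B'}
    (h : B = B') (hfg : HEq f g) : f ≫ eqToHom h = g := by
  subst h
  simpa using hfg

theorem comp_eqToHom_eq_of_heq {V : Type u} [Category.{v} V] {A A' B B' : V} {f : A ⟶ B}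
    {g : A' ⟶ B'} (hA : A = A') (hB : B = B') (hfg : HEq f g) :
    f ≫ eqToHom hB = eqToHom hA ≫ g := by
  subst hA hB
  simpa using hfg

theorem comp_eqToHom_le_iff {V : Type u} [Category.{v} V] [OmegaCpoCategory V] {A B B' : V}
    (h : B = B') {f g : A ⟶ B} : f ≫ eqToHom h ≤ g ≫ eqToHom h ↔ f ≤ g := by
  subst h
  simp

theorem comp_le_comp_left {V : Type u} [Category.{v} V] [OmegaCpoCategory V] {A B C : V}
    {f g : A ⟶ B} (h : f ≤ g) (k : B ⟶ C) : f ≫ k ≤ g ≫ k :=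
  (OmegaCpoCategory.comp_continuous A B C).monotone
    (show (f, k) ≤ (g, k) from ⟨h, le_rfl⟩)

/-- Composition with `g` is monotone, so an inequality after `f` persists after `f ≫ g`, where it is
reflected. -/
theorem FullMorphism.of_comp {V : Type u} [Category.{v} V] [OmegaCpoCategory V] {A B C : V}
    {f : A ⟶ B} {g : B ⟶ C} (h : FullMorphism (f ≫ g)) : FullMorphism f := fun D x y hxy =>
  h D (by simpa only [Category.assoc] using comp_le_comp_left hxy g)

/-- Arrows into and out of a zero object are unique, so any two are the ones already known to form
an ep-pair. -/
theorem IsEpZero.isEpPair_of {C : Type u} [Category.{v} C] [∀ X Y : C, PartialOrder (X ⟶ Y)]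
    {Z A : C} (hZ : IsEpZero Z) (e : Z ⟶ A) (p : A ⟶ Z) : IsEpPair e p := by
  rw [hZ.isZero.eq_of_src e (hZ.isZero.to_ A), hZ.isZero.eq_of_tgt p (hZ.isZero.from_ A)]
  exact hZ.isEpPair A

namespace LiftsMonad

variable {V : Type u} [Category.{v} V] {V' : Type u'} [Category.{v'} V'] {H : V ⥤ V'}
  {S : Monad V} {T : Monad V'} (h : LiftsMonad H S T)

include h in
theorem obj_eq (X : V) : H.obj (S.obj X) = T.obj (H.obj X) := Functor.congr_obj h.functor_eq X

/-- The functor between Kleisli categories induced by a lifting of monads. -/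
def kleisliMap {X Y : Kleisli S} (f : X ⟶ Y) :
    Kleisli.mk T (H.obj X.of) ⟶ Kleisli.mk T (H.obj Y.of) :=
  ⟨H.map f.of ≫ eqToHom (h.obj_eq Y.of)⟩

theorem unit_comp (X : V) : H.map (S.η.app X) ≫ eqToHom (h.obj_eq X) = T.η.app (H.obj X) :=
  comp_eqToHom_of_heq _ (h.unit_eq X)

theorem map_comp_eqToHom {X Y : V} (f : X ⟶ Y) :
    H.map (S.map f) ≫ eqToHom (h.obj_eq Y) = eqToHom (h.obj_eq X) ≫ T.map (H.map f) := by
  have := Functor.congr_hom h.functor_eq f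
  simp only [Functor.comp_map] at this
  rw [this]
  simp

theorem mul_comp (X : V) : H.map (S.μ.app X) ≫ eqToHom (h.obj_eq X) =
    eqToHom (h.obj_eq (S.obj X)) ≫ T.map (eqToHom (h.obj_eq X)) ≫ T.μ.app (H.obj X) := by
  rw [eqToHom_map, eqToHom_trans_assoc]
  exact comp_eqToHom_eq_of_heq _ _ (h.mul_eq X)

theorem kleisliMap_id (X : Kleisli S) : h.kleisliMap (𝟙 X) = 𝟙 _ :=
  Kleisli.hom_ext (h.unit_comp X.of)

/-- The transport is moved past the multiplication and then past the action of the monad on `g`. -/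
theorem kleisliMap_comp {X Y Z : Kleisli S} (f : X ⟶ Y) (g : Y ⟶ Z) :
    h.kleisliMap (f ≫ g) = h.kleisliMap f ≫ h.kleisliMap g := by
  refine Kleisli.hom_ext ?_
  change H.map (f.of ≫ S.map g.of ≫ S.μ.app Z.of) ≫ _ =
    (H.map f.of ≫ eqToHom (h.obj_eq Y.of)) ≫
      T.map (H.map g.of ≫ eqToHom (h.obj_eq Z.of)) ≫ T.μ.app (H.obj Z.of)
  simp only [Functor.map_comp, Category.assoc]
  rw [h.mul_comp, ← Category.assoc (H.map (S.map g.of)), h.map_comp_eqToHom, Category.assoc]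

theorem kleisliMap_toKleisli {X Y : V} (f : X ⟶ Y) :
    h.kleisliMap ((Kleisli.Adjunction.toKleisli S).map f) =
      (Kleisli.Adjunction.toKleisli T).map (H.map f) :=
  Kleisli.hom_ext <| (congrArg (· ≫ eqToHom (h.obj_eq Y)) (H.map_comp f _)).trans <|
    (Category.assoc _ _ _).trans (congrArg (H.map f ≫ ·) (h.unit_comp Y))

end LiftsMonad

/-! ### Order, ep-pairs and units compared with those over `V` -/

namespace Subscone

variable {V : Type u} [Category.{v} V] {G : V ⥤ ωCPO.{v}} {S : Monad (Subscone G)} {T : Monad V}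
  (h : LiftsMonad (forget G) S T)

include h in
-- The morphism `f` found in `V`, followed by the unit at `B`, is the underlying morphism of `e` and
-- so respects the predicates. Since the unit square is a pullback, `f` itself respects them.
-- Uniqueness descends because the forgetful functor is faithful.
theorem existsUnique_toKleisli_map
    (hS : ∀ X, IsPullbackHom (S.η.app X)) {A B : Subscone G}
    (e : (Kleisli.Adjunction.toKleisli S).obj A ⟶ (Kleisli.Adjunction.toKleisli S).obj B)
    (he : ∃! f : A.obj.right ⟶ B.obj.right,
      (Kleisli.Adjunction.toKleisli T).map f = h.kleisliMap e) :
    ∃! f : A ⟶ B, (Kleisli.Adjunction.toKleisli S).map f = e := by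
  obtain ⟨f, hf, huniq⟩ := he
  -- The identity of Kleisli arrows over `V` carries a transport of codomains; it is an isomorphism
  -- and can be cancelled.
  have hfe : f ≫ (S.η.app B).hom.right = e.of.hom.right :=
    (cancel_mono (eqToHom (h.obj_eq B))).1 <| (Category.assoc _ _ _).trans <|
      (congrArg (f ≫ ·) (h.unit_comp B)).trans (congrArg Kleisli.Hom.of hf)
  refine ⟨homOfPred f fun z hz => pred_of_isPullbackHom (hS B) ?_,
    Kleisli.hom_ext (hom_ext hfe), fun g hg => hom_ext (huniq _ ?_)⟩
  · refine (congrArg (S.obj B).pred (gmap_comp f _ z)).mp ?_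
    exact (congrArg (fun k => (S.obj B).pred (gmap G k z)) hfe).mpr (pred_map e.of hz)
  · rw [← hg]
    exact (h.kleisliMap_toKleisli g).symm

variable [OmegaCpoCategory V] [OmegaCpoFunctor G]

theorem kleisliMap_le_iff {X Y : Kleisli S} {f g : X ⟶ Y} :
    h.kleisliMap f ≤ h.kleisliMap g ↔ f ≤ g :=
  (comp_eqToHom_le_iff (h.obj_eq Y.of)).trans le_iff.symm

theorem kleisliMap_injective {X Y : Kleisli S} {f g : X ⟶ Y}
    (hfg : h.kleisliMap f = h.kleisliMap g) : f = g :=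
  le_antisymm ((kleisliMap_le_iff h).1 hfg.le) ((kleisliMap_le_iff h).1 hfg.ge)

/-- The comparison of Kleisli categories is functorial, faithful and preserves and reflects the
order, and ep-pairs are defined by one equation and one inequality. -/
theorem isEpPair_kleisliMap {X Y : Kleisli S} {e : X ⟶ Y} {p : Y ⟶ X} :
    IsEpPair (h.kleisliMap e) (h.kleisliMap p) ↔ IsEpPair e p := by
  constructor
  · rintro ⟨h1, h2⟩
    rw [← h.kleisliMap_comp, ← h.kleisliMap_id] at h1 h2
    exact ⟨kleisliMap_injective h h1, (kleisliMap_le_iff h).1 h2⟩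
  · rintro ⟨h1, h2⟩
    refine ⟨?_, ?_⟩
    · rw [← h.kleisliMap_comp, h1, h.kleisliMap_id]
    · rw [← h.kleisliMap_comp, ← h.kleisliMap_id]
      exact (kleisliMap_le_iff h).2 h2

include h in
-- Up to a transport the unit of `S` lies over that of `T`, which is full, and inequalities in the
-- subscone are those of `V`.
theorem fullMorphism_unit {X : Subscone G} (hT : FullMorphism (T.η.app X.obj.right)) :
    FullMorphism (S.η.app X) := fun B f g hfg => by
  have hX : FullMorphism ((forget G).map (S.η.app X)) :=
    FullMorphism.of_comp (g := eqToHom (h.obj_eq X)) ((h.unit_comp X).symm ▸ hT)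
  exact le_iff.2 (hX _ (le_iff.1 hfg))

include h in
/-- An object over an ep-zero object whose image under the lifted monad is terminal is an ep-zero
object. -/
theorem isEpZero {Z : Subscone G} (hZ : IsInitial Z) (hSZ : IsTerminal (S.obj Z))
    (hT : IsEpZero ((Kleisli.Adjunction.toKleisli T).obj Z.obj.right)) :
    IsEpZero ((Kleisli.Adjunction.toKleisli S).obj Z) where
  isZero :=
    -- A Kleisli arrow out of `Z` is a morphism from the initial object, and one into `Z` is a
    -- morphism to the terminal object `S Z`.
    { unique_to := fun Y => ⟨⟨⟨⟨hZ.to (S.obj Y.of)⟩⟩,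
        fun _ => Kleisli.hom_ext (hZ.hom_ext _ _)⟩⟩
      unique_from := fun Y => ⟨⟨⟨⟨hSZ.from Y.of⟩⟩,
        fun _ => Kleisli.hom_ext (hSZ.hom_ext _ _)⟩⟩ }
  isEpPair _ := (isEpPair_kleisliMap h).1 (hT.isEpPair_of _ _)

end Subscone

/-! ### The subscone as an rCBV `ωCpo`-pair -/

section Main

variable {V : Type u} [Category.{v} V] [CartesianMonoidalCategory V]

namespace BicartesianClosed

/-- The lifting to the subscone of the bicartesian closed structure of `V`. -/
noncomputable def subscone (P : BicartesianClosed V) {G : V ⥤ ωCPO.{v}} (hG : PreservesPairs G) :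
    BicartesianClosed (Subscone G) where
  closed := ⟨fun X => ⟨Subscone.expFunctor P.ihomAdj hG X, Subscone.expAdj P.ihomAdj hG X⟩⟩
  zero := Subscone.bot G P.zero
  zeroIsInitial := Subscone.botIsInitial P.zeroIsInitial
  coprod X Y := Subscone.coprodObj (P.inl X.obj.right Y.obj.right) (P.inr X.obj.right Y.obj.right)
  inl _ _ := Subscone.coprodInl _ _
  inr _ _ := Subscone.coprodInr _ _
  coprodIsColimit _ _ := Subscone.coprodIsColimit _ _ (P.coprodIsColimit _ _)

theorem subscone_strict (P : BicartesianClosed V) {G : V ⥤ ωCPO.{v}} (hG : PreservesPairs G) :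
    IsStrictBicartesianClosed (P.subscone hG) P (Subscone.forget G) where
  unit_obj := rfl
  tensor_obj _ _ := rfl
  map_fst _ _ := HEq.rfl
  map_snd _ _ := HEq.rfl
  exp_obj _ _ := rfl
  map_ev X Y := heq_of_eq (Subscone.right_expAdj_counit P.ihomAdj hG X Y)
  zero_obj := rfl
  coprod_obj _ _ := rfl
  map_inl _ _ := HEq.rfl
  map_inr _ _ := HEq.rfl

end BicartesianClosed

/-- The lifting to the subscone of the structure of an rCBV `ωCpo`-pair. -/
noncomputable def RCBVPair.subscone [OmegaCpoCategory V] {T : StrongMonad V} (P : RCBVPair T) {G : V ⥤ ωCPO.{v}}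
    [OmegaCpoFunctor G] (hG : PreservesPairs G) {L : StrongMonad (Subscone G)}
    (hL : LiftsMonad (Subscone.forget G) L.toMonad T.toMonad)
    (hA : ∀ X : Subscone G, IsPullbackHom (L.η.app X))
    (hB : Nonempty (IsTerminal (L.obj (Subscone.bot G P.zero)))) : RCBVPair L where
  toBicartesianClosed := P.toBicartesianClosed.subscone hG
  colim W _ K _ := Subscone.liftCocone (P.colim W (K ⋙ Subscone.forget G))
  colimIsColimit W _ K _ := Subscone.liftCocone_isColimit _ (P.colimIsColimit W _)
  prod_le f g h1 h2 := Subscone.le_iff.2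
    (P.prod_le f.hom.right g.hom.right (Subscone.le_iff.1 h1) (Subscone.le_iff.1 h2))
  tensor_omegaCpo X := ⟨fun Y Z => Subscone.continuous_of_right <| by
    have h := ((P.tensor_omegaCpo X.obj.right).map_continuous Y.obj.right Z.obj.right).comp
      (Subscone.continuous_right Y Z)
    exact (funext fun f => Subscone.right_whiskerLeft X f :
      (fun f : Y ⟶ Z => (X ◁ f).hom.right) = _) ▸ h⟩
  ihom_omegaCpo X := ⟨fun Y Z => Subscone.continuous_of_right <| by
    have h := ((P.ihom_omegaCpo X.obj.right).map_continuous Y.obj.right Z.obj.right).comp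
      (Subscone.continuous_right Y Z)
    exact (funext fun f => Subscone.right_expFunctor_map P.ihomAdj hG X f :
      (fun f : Y ⟶ Z => ((Subscone.expFunctor P.ihomAdj hG X).map f).hom.right) = _) ▸ h⟩
  ihom_adj X Y Z f g := by
    change (Subscone.expAdj P.ihomAdj hG X).homEquiv Y Z f ≤
      (Subscone.expAdj P.ihomAdj hG X).homEquiv Y Z g ↔ _
    rw [Subscone.expAdj_homEquiv, Subscone.le_iff, Subscone.le_iff]
    exact P.ihom_adj X.obj.right Y.obj.right Z.obj.right f.hom.right g.hom.right
  unit_full X := Subscone.fullMorphism_unit hL (P.unit_full X.obj.right)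
  epZero := Subscone.isEpZero hL (Subscone.botIsInitial P.zeroIsInitial) hB.some P.epZero
  lift_embedding e p hep := Subscone.existsUnique_toKleisli_map hL hA e
    (P.lift_embedding _ _ ((Subscone.isEpPair_kleisliMap hL).2 hep))

end Main

end OmegaCpo

theorem mainTheorem3 {V : Type u} [Category.{v} V] [OmegaCpo.OmegaCpoCategory V]
    [CartesianMonoidalCategory V] (T : OmegaCpo.StrongMonad V) (P : OmegaCpo.RCBVPair T)
    (G : V ⥤ ωCPO.{v}) [OmegaCpo.OmegaCpoFunctor G] (hG : OmegaCpo.IsRightOmegaCpoAdjoint G)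
    (L : OmegaCpo.StrongMonad (OmegaCpo.Subscone G))
    (hL : OmegaCpo.LiftsMonad (OmegaCpo.Subscone.forget G) L.toMonad T.toMonad)
    (hA : ∀ X : OmegaCpo.Subscone G, OmegaCpo.IsPullbackHom (L.η.app X))
    (hB : Nonempty (IsTerminal (L.obj (OmegaCpo.Subscone.bot G P.zero)))) :
    ∃ Q : OmegaCpo.RCBVPair L,
      OmegaCpo.IsRCBVPairMorphism Q P (OmegaCpo.Subscone.forget G) := by
  have hG' := hG.preservesPairs P.prod_le
  exact ⟨P.subscone hG' hL hA hB,
    { omegaCpo := inferInstance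
      strict_colim := fun _ _ _ _ => OmegaCpo.Subscone.liftCocone_map _
      isCBVPairMorphism := ⟨P.toBicartesianClosed.subscone_strict hG', hL⟩ }⟩
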